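/- All logarithms are to base $2$. For a probability distribution $P$ on a finite set, let $H(P)=-\sum_x P(x)\log P(x)$ and $V(P)=\sum_x P(x)(-\log P(x)-H(P))^2$; let $P^n$ be the $n$-fold i.i.d. distribution, $U_l$ the uniform distribution on an $l$-element set, and $F(Q,Q')=\sum_y\sqrt{Q(y)Q'(y)}$ the fidelity. Let $W(P)$ be the image of $P$ under a map $W$, and write $P\prec Q$ ($P$ is majorized by $Q$) if for each $k$ the sum of the $k$ largest values of $P$ is at most that of $Q$ (values beyond the size of the underlying set counting as $0$). For real $N$ let $\mathcal B_N$ be a set of cardinality $\lfloor 2^N\rfloor$ (a storage of $N$ bits). For distributions $P$ on $\mathcal X$ and $Q$ on $\mathcal Y$ put $$F^{\mathcal D}(P\to Q|N)=\sup\{F(W'(W(P)),Q) : W:\mathcal X\to\mathcal B_N,\ W':\mathcal B_N\to\mathcal Y\},$$ $$F^{\mathcal M}(P\to Q|N)=\sup\{F(P'',Q) : P\prec P'\prec P'',\ P'\in\mathcal P(\mathcal B_N),\ P''\in\mathcal P(\mathcal Y)\},$$ where $\mathcal P(\cdot)$ denotes the set of probability distributions on a set and a supremum over the empty set is $0$.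 For $i\in\{\mathcal D,\mathcal M\}$ and $s_2,t_2\in\mathbb R$ put $$F^{i}_{P,Q,s_2}(t_2)=\liminf_{n\to\infty}F^{i}\Bigl(P^n\to Q^{T_n}\,\Big|\,H(P)n+s_2\sqrt n\Bigr),\qquad T_n=\max\Bigl\{0,\Bigl\lfloor \tfrac{H(P)}{H(Q)}n+t_2\sqrt n\Bigr\rfloor\Bigr\}.$$ Let $\Phi$ be the standard normal distribution function, $D_{P,Q}=H(Q)/\sqrt{V(P)}$, and $Z_{0,s}(\mu)=\Phi(\mu)$ if $\mu\le s$, $Z_{0,s}(\mu)=1$ if $\mu>s$. **Theorem.** Let $P$ be a probability distribution on a finite set that is not uniform on its support, let $l\ge2$ be an integer, and let $s_2\in\mathbb R$. Then there is a function $F_{P,U_l,s_2}:\mathbb R\to\mathbb R$ with $$F_{P,U_l,s_2}(t_2)=F^{\mathcal D}_{P,U_l,s_2}(t_2)=F^{\mathcal M}_{P,U_l,s_2}(t_2)\qquad\text{for all } t_2\in\mathbb R,$$ it is continuous and strictly decreasing on $F_{P,U_l,s_2}^{-1}((0,1))$, and for all $t_2\in\mathbb R$ $$F_{P,U_l,s_2}(t_2)=\begin{cases}\sqrt{\Phi\left(\frac{-\log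 l}{\sqrt{V(P)}}\,t_2\right)} & \text{if }(\log l)\,t_2\le s_2,\\ 0&\text{otherwise,}\end{cases}$$ $$F_{P,U_l,s_2}(t_2)=\sqrt{1-Z_{0,\,s_2/\sqrt{V(P)}}\bigl(t_2D_{P,U_l}\bigr)}.$$ -/

import Mathlib

/-! Finite probability distributions are elements of Mathlib's `stdSimplex ℝ X`
(nonnegative functions `X → ℝ` of total mass one).  All logarithms are to the base `2`. -/

namespace RNC

noncomputable section

/-- Not uniform on its support: two outcomes of positive probability have different
probabilities. -/
def NonUniform {X : Type*} (P : X → ℝ) : Prop :=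
  ∃ x y, 0 < P x ∧ 0 < P y ∧ P x ≠ P y

/-- The uniform distribution `U_l` on an `l`-element set. -/
def unif (l : ℕ) : Fin l → ℝ := fun _ => (l : ℝ)⁻¹

/-- The `n`-fold i.i.d. distribution `Pⁿ` on `Xⁿ`. -/
def iid {X : Type*} (P : X → ℝ) (n : ℕ) : (Fin n → X) → ℝ := fun x => ∏ i, P (x i)

/-- Shannon entropy `H(P)`, in bits. -/
def entropy {X : Type*} [Fintype X] (P : X → ℝ) : ℝ :=
  -∑ x, P x * Real.logb 2 (P x)

/-- The varentropy `V(P)`, that is, the variance of `-log P`. -/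
def varentropy {X : Type*} [Fintype X] (P : X → ℝ) : ℝ :=
  ∑ x, P x * (-Real.logb 2 (P x) - entropy P) ^ 2

/-- The coefficient `D_{P,Q} = H(Q) / √V(P)`. -/
def coeffD {X Y : Type*} [Fintype X] [Fintype Y] (P : X → ℝ) (Q : Y → ℝ) : ℝ :=
  entropy Q / √(varentropy P)

/-- Fidelity (Bhattacharyya coefficient). -/
def fidelity {Y : Type*} [Fintype Y] (Q Q' : Y → ℝ) : ℝ := ∑ y, √(Q y) * √(Q' y)

/-- The image distribution `W(P)` of `P` under the deterministic conversion `W`. -/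
def image {X Y : Type*} [Fintype X] [DecidableEq Y] (W : X → Y) (P : X → ℝ) : Y → ℝ :=
  fun y => ∑ x with W x = y, P x

/-- The decreasing rearrangement `P↓`, as a list. -/
def decreasing {X : Type*} [Fintype X] (P : X → ℝ) : List ℝ :=
  (Finset.univ.val.map P).sort (· ≥ ·)

/-- `P ≺ Q` (`P` is majorized by `Q`): for every `k`, the sum of the `k` largest values of `P` is
at most that of `Q`.  A list shorter than `k` contributes its whole sum. -/
def Majorized {X Y : Type*} [Fintype X] [Fintype Y] (P : X → ℝ) (Q : Y → ℝ) : Prop :=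
  ∀ k : ℕ, ((decreasing P).take k).sum ≤ ((decreasing Q).take k).sum

/-- The storage of `N` bits.  The number `N` of bits may be any real number; the storage is
the largest set of cardinality at most `2 ^ N` (exactly `2 ^ N` when `N` is a natural number). -/
abbrev Storage (N : ℝ) : Type := Fin ⌊(2 : ℝ) ^ N⌋₊

/-- `F^𝒟(P → Q | N)`: maximal fidelity of deterministic conversions through an `N`-bit storage. -/
def fidD {X Y : Type*} [Fintype X] [Fintype Y] [DecidableEq Y]
    (P : X → ℝ) (Q : Y → ℝ) (N : ℝ) : ℝ :=
  sSup {r | ∃ (W : X → Storage N) (W' : Storage N → Y), r = fidelity (image W' (image W P)) Q}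

/-- `F^ℳ(P → Q | N)`: maximal fidelity of majorization conversions through an `N`-bit storage. -/
def fidM {X Y : Type*} [Fintype X] [Fintype Y]
    (P : X → ℝ) (Q : Y → ℝ) (N : ℝ) : ℝ :=
  sSup {r | ∃ P' ∈ stdSimplex ℝ (Storage N), ∃ P'' ∈ stdSimplex ℝ Y,
    Majorized P P' ∧ Majorized P' P'' ∧ r = fidelity P'' Q}

/-- The asymptotic fidelity `F^𝒟_{P,Q,s₁,t₁,s₂}(t₂)`: storage of `s₁ n + s₂ √n` bits, and
`⌊t₁ n + t₂ √n⌋` copies of the target. -/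
def asympFidD {X Y : Type*} [Fintype X] [Fintype Y] [DecidableEq Y]
    (P : X → ℝ) (Q : Y → ℝ) (s₁ t₁ s₂ t₂ : ℝ) : ℝ :=
  Filter.liminf (fun n : ℕ =>
    fidD (iid P n) (iid Q ⌊t₁ * n + t₂ * √(n : ℝ)⌋₊) (s₁ * n + s₂ * √(n : ℝ))) Filter.atTop

/-- The asymptotic fidelity `F^ℳ_{P,Q,s₁,t₁,s₂}(t₂)`. -/
def asympFidM {X Y : Type*} [Fintype X] [Fintype Y]
    (P : X → ℝ) (Q : Y → ℝ) (s₁ t₁ s₂ t₂ : ℝ) : ℝ :=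
  Filter.liminf (fun n : ℕ =>
    fidM (iid P n) (iid Q ⌊t₁ * n + t₂ * √(n : ℝ)⌋₊) (s₁ * n + s₂ * √(n : ℝ))) Filter.atTop

/-- `F^𝒟_{P,Q,s₂}(t₂)`, at the first-order rates `s₁ = H(P)`, `t₁ = H(P) / H(Q)`. -/
def secondFidD {X Y : Type*} [Fintype X] [Fintype Y] [DecidableEq Y]
    (P : X → ℝ) (Q : Y → ℝ) (s₂ t₂ : ℝ) : ℝ :=
  asympFidD P Q (entropy P) (entropy P / entropy Q) s₂ t₂

/-- `F^ℳ_{P,Q,s₂}(t₂)`, at the first-order rates `s₁ = H(P)`, `t₁ = H(P) / H(Q)`. -/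
def secondFidM {X Y : Type*} [Fintype X] [Fintype Y]
    (P : X → ℝ) (Q : Y → ℝ) (s₂ t₂ : ℝ) : ℝ :=
  asympFidM P Q (entropy P) (entropy P / entropy Q) s₂ t₂

/-- `Φ`, the cumulative distribution function of the standard normal distribution. -/
def Phi (x : ℝ) : ℝ := ProbabilityTheory.cdf (ProbabilityTheory.gaussianReal 0 1) x

/-- The generalized Rayleigh-normal distribution function `Z_{0,s}`, that is, with `v = 0`. -/
def Z0 (s μ : ℝ) : ℝ := if μ ≤ s then Phi μ else 1

end

end RNC

namespace RNC

open MeasureTheory ProbabilityTheory Filter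
open scoped Topology

/-! The target is uniform on `M = l ^ T` points, with `log M` equal to `H(P) n + (log l) t₂ √n` up
to a bounded error. Converse (`fidelity_const_le`): if `P ≺ R`, then for every set `S` the fidelity
of `R` with that target is at most `√(|S| / M) + √(1 - P(S))`. With `S` the sequences of probability
at least `2 ^ (-(n H(P) + a √n))` and `a < (log l) t₂`, the first term vanishes, and the central
limit theorem sends `P(S)` to `Φ(a / √V)`; then `a` approaches `(log l) t₂`. Applied instead to the
distribution on the storage, with `S` everything, the bound is `√(2 ^ N / M)`, which tends to `0`
when `(log l) t₂ > s₂`. Achievability (`le_fidD_const`): if `M ≤ 2 ^ N`, the storage is no obstacle.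
Spreading the outcomes of probability at most `δ` evenly over `M` bins gives fidelity at least
`√(P(P ≤ δ) - δ M)`; here `δ = 2 ^ (-(n H(P) + b √n))` with `b` slightly above `(log l) t₂`.
Deterministic conversions are majorization conversions, so the two bounds enclose both quantities.
-/

/-! ### Majorization and largest partial sums -/

theorem sum_le_sum_take_decreasing {X : Type*} [Fintype X] {P : X → ℝ} (hP : ∀ x, 0 ≤ P x)
    {k : ℕ} {S : Finset X} (hS : S.card ≤ k) :
    ∑ x ∈ S, P x ≤ ((decreasing P).take k).sum := by
  classical
  -- Induction matching heads: the head of a decreasing list dominates the head of any sublist.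
  -- Nonnegativity covers sublists shorter than `k`.
  have key : ∀ (L : List ℝ), L.Pairwise (· ≥ ·) → (∀ a ∈ L, 0 ≤ a) → ∀ (k : ℕ) (M : List ℝ),
      M.Sublist L → M.length ≤ k → M.sum ≤ (L.take k).sum := by
    intro L
    induction L with
    | nil => intro _ _ k M hM _; simp [List.sublist_nil.1 hM]
    | cons a L ih =>
      intro hL h0 k M hM hk
      rw [List.pairwise_cons] at hL
      have h0' : ∀ b ∈ L, 0 ≤ b := fun b hb => h0 b (List.mem_cons_of_mem _ hb)
      cases k with
      | zero =>
        have : M = [] := List.length_eq_zero_iff.1 (by omega)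
        simp [this]
      | succ k =>
        rw [List.take_succ_cons, List.sum_cons]
        cases M with
        | nil =>
          have h1 : 0 ≤ (L.take k).sum :=
            List.sum_nonneg fun b hb => h0' b (List.mem_of_mem_take hb)
          have h2 : 0 ≤ a := h0 a List.mem_cons_self
          simp only [List.sum_nil]; linarith
        | cons b M =>
          have hk' : M.length ≤ k := by simpa using hk
          rw [List.sum_cons]
          have hML : M.Sublist L := List.cons_sublist_cons'.1 hM |>.elim
            (fun h => (List.sublist_cons_self b M).trans h) fun h => h.2
          have hba : b ≤ a := by
            rcases List.mem_cons.1 (hM.subset List.mem_cons_self) with h | h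
            · exact h.le
            · exact hL.1 b h
          have := ih hL.2 h0' k M hML hk'
          linarith
  have hle : ((S.val.map P).sort (· ≥ ·)).Subperm (decreasing P) := by
    rw [← Multiset.coe_le, decreasing, Multiset.sort_eq, Multiset.sort_eq]
    exact Multiset.map_le_map (Finset.val_le_iff.2 (Finset.subset_univ S))
  obtain ⟨M, hMp, hMs⟩ := hle
  have hsum : M.sum = ∑ x ∈ S, P x := by
    rw [hMp.sum_eq, ← Multiset.sum_coe, Multiset.sort_eq]; rfl
  have hlen : M.length = S.card := by
    rw [hMp.length_eq, Multiset.length_sort, Multiset.card_map]; rfl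
  rw [← hsum]
  refine key _ ?_ ?_ k M hMs (by omega)
  · exact Multiset.pairwise_sort _ _
  · intro a ha
    rw [decreasing, Multiset.mem_sort, Multiset.mem_map] at ha
    obtain ⟨x, -, rfl⟩ := ha
    exact hP x

theorem exists_sum_eq_sum_take_decreasing {X : Type*} [Fintype X] (P : X → ℝ) (k : ℕ) :
    ∃ S : Finset X, S.card ≤ k ∧ ∑ x ∈ S, P x = ((decreasing P).take k).sum := by
  classical
  have hle : ((decreasing P).take k).Subperm (Finset.univ.toList.map P) := by
    refine (List.take_sublist _ _).subperm.trans (List.Perm.subperm ?_)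
    rw [← Multiset.coe_eq_coe, decreasing, Multiset.sort_eq, ← Multiset.map_coe,
      Finset.coe_toList]
  obtain ⟨M, hMp, hMs⟩ := hle
  obtain ⟨T, hT, rfl⟩ := List.sublist_map_iff.1 hMs
  have hTn : T.Nodup := hT.nodup Finset.univ.nodup_toList
  refine ⟨T.toFinset, ?_, ?_⟩
  · rw [List.toFinset_card_of_nodup hTn, ← List.length_map P, hMp.length_eq]
    exact List.length_take_le _ _
  · rw [List.sum_toFinset _ hTn, hMp.sum_eq]

theorem Majorized.trans {X Y Z : Type*} [Fintype X] [Fintype Y] [Fintype Z] {P : X → ℝ}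
    {Q : Y → ℝ} {R : Z → ℝ} (h₁ : Majorized P Q) (h₂ : Majorized Q R) : Majorized P R :=
  fun k => (h₁ k).trans (h₂ k)

/-! ### Deterministic maps -/

section Image

variable {X Y Z : Type*} [Fintype X] [DecidableEq Y]

theorem image_mem_stdSimplex [Fintype Y] {P : X → ℝ} (hP : P ∈ stdSimplex ℝ X) (W : X → Y) :
    image W P ∈ stdSimplex ℝ Y := by
  refine ⟨fun y => Finset.sum_nonneg fun x _ => hP.1 x, ?_⟩
  unfold image
  rw [Finset.sum_fiberwise]
  exact hP.2

theorem image_image [Fintype Y] [DecidableEq Z] (W : X → Y) (W' : Y → Z) (P : X → ℝ) :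
    image W' (image W P) = image (W' ∘ W) P := by
  funext z
  unfold image
  rw [Finset.sum_comm' (t' := Finset.univ.filter fun x => W' (W x) = z)
    (s' := fun x => {W x})]
  · simp
  · intro x y
    simp only [Finset.mem_filter, Finset.mem_univ, true_and, Finset.mem_singleton]
    constructor
    · rintro ⟨h, h'⟩; exact ⟨h'.symm, by rw [h', h]⟩
    · rintro ⟨h, h'⟩; exact ⟨by rw [h, h'], h.symm⟩

/-- The `k` heaviest outcomes land on at most `k` points, whose fibres contain them. -/
theorem majorized_image [Fintype Y] {P : X → ℝ} (hP : P ∈ stdSimplex ℝ X) (W : X → Y) :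
    Majorized P (image W P) := by
  intro k
  obtain ⟨S, hS, hSe⟩ := exists_sum_eq_sum_take_decreasing P k
  rw [← hSe]
  refine le_trans ?_ (sum_le_sum_take_decreasing (image_mem_stdSimplex hP W).1
    (Finset.card_image_le.trans hS : (S.image W).card ≤ k))
  rw [← Finset.sum_fiberwise_of_maps_to (t := S.image W) (g := W)
    fun x hx => Finset.mem_image_of_mem W hx]
  refine Finset.sum_le_sum fun y _ => ?_
  exact Finset.sum_le_sum_of_subset_of_nonneg
    (Finset.filter_subset_filter _ (Finset.subset_univ S)) fun x _ _ => hP.1 x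

end Image

/-! ### One-shot bounds for a uniform target -/

/-- A conversion majorizing `P` cannot approximate a uniform distribution on `M` points better
than the mass that `P` puts outside a small set `S` allows. -/
theorem fidelity_const_le {X Y : Type*} [Fintype X] [Fintype Y] {P : X → ℝ} {R : Y → ℝ}
    (hP : P ∈ stdSimplex ℝ X) (hR : R ∈ stdSimplex ℝ Y) (hPR : Majorized P R) {M : ℕ}
    (hM : Fintype.card Y = M) (S : Finset X) :
    fidelity R (fun _ => (M : ℝ)⁻¹) ≤ √(S.card / M) + √(1 - ∑ x ∈ S, P x) := by
  classical
  -- `T` carries the largest values of `R`, so majorization turns mass of `P` on `S` into mass of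
  -- `R` on `T`.
  obtain ⟨T, hT, hTe⟩ := exists_sum_eq_sum_take_decreasing R S.card
  have hST : ∑ x ∈ S, P x ≤ ∑ y ∈ T, R y := by
    rw [hTe]; exact (sum_le_sum_take_decreasing hP.1 le_rfl).trans (hPR _)
  have hsplit := Finset.sum_add_sum_compl T R
  rw [hR.2] at hsplit
  have hT1 : ∑ y ∈ T, R y ≤ 1 := by
    have : 0 ≤ ∑ y ∈ Tᶜ, R y := Finset.sum_nonneg fun y _ => hR.1 y
    linarith
  -- Cauchy–Schwarz, used on `T` and on its complement.
  have hC : ∀ U : Finset Y, ∑ y ∈ U, √(R y) * √((M : ℝ)⁻¹) ≤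
      √(∑ y ∈ U, R y) * √(U.card / M) := by
    intro U
    have := Real.sum_sqrt_mul_sqrt_le U (f := R) (g := fun _ => (M : ℝ)⁻¹) hR.1
      (fun _ => by positivity)
    simpa [div_eq_mul_inv] using this
  rw [fidelity, ← Finset.sum_add_sum_compl T]
  refine add_le_add ((hC T).trans ?_) ((hC Tᶜ).trans ?_)
  · calc √(∑ y ∈ T, R y) * √(T.card / M) ≤ 1 * √(S.card / M) := by
          gcongr
          exact Real.sqrt_le_one.2 hT1
      _ = _ := one_mul _
  · have hc : (Tᶜ.card : ℝ) / M ≤ 1 := by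
      apply div_le_one_of_le₀ _ (Nat.cast_nonneg _)
      rw [← hM]
      exact_mod_cast Finset.card_le_univ _
    calc √(∑ y ∈ Tᶜ, R y) * √(Tᶜ.card / M) ≤ √(1 - ∑ x ∈ S, P x) * 1 := by
          gcongr
          · linarith
          · exact Real.sqrt_le_one.2 hc
      _ = _ := mul_one _

theorem fidelity_nonneg {Y : Type*} [Fintype Y] (Q Q' : Y → ℝ) : 0 ≤ fidelity Q Q' :=
  Finset.sum_nonneg fun _ _ => by positivity

/-- Assigning items one after the other to a least loaded bin gives nearly equal loads. -/
theorem exists_balanced_assignment {X Y : Type*} [DecidableEq Y] [Fintype Y] [Nonempty Y]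
    {w : X → ℝ} {δ : ℝ} (hδ : 0 ≤ δ) (S : Finset X) (hw : ∀ x ∈ S, 0 ≤ w x ∧ w x ≤ δ) :
    ∃ f : X → Y, ∀ y z, ∑ x ∈ S with f x = y, w x ≤ ∑ x ∈ S with f x = z, w x + δ := by
  classical
  induction S using Finset.induction_on with
  | empty => exact ⟨fun _ => Classical.arbitrary Y, by simpa using hδ⟩
  | insert a S ha ih =>
    obtain ⟨f, hf⟩ := ih fun x hx => hw x (Finset.mem_insert_of_mem hx)
    -- The new item goes to the least loaded bin `m`, which then exceeds any other bin by at most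
    -- the item's weight.
    obtain ⟨m, hm⟩ := Finite.exists_min fun y => ∑ x ∈ S with f x = y, w x
    obtain ⟨hw0, hwδ⟩ := hw a (Finset.mem_insert_self a S)
    have key : ∀ y, ∑ x ∈ insert a S with Function.update f a m x = y, w x =
        (if m = y then w a else 0) + ∑ x ∈ S with f x = y, w x := by
      intro y
      rw [Finset.sum_filter, Finset.sum_insert ha, Function.update_self, Finset.sum_filter]
      congr 1
      refine Finset.sum_congr rfl fun x hx => ?_
      rw [Function.update_of_ne fun h : x = a => ha (h ▸ hx)]
    refine ⟨Function.update f a m, fun y z => ?_⟩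
    rw [key, key]
    have h1 := hf y z
    have h2 := hm z
    split_ifs with hy hz hz
    · subst hy; linarith
    · subst hy; linarith
    · linarith
    · linarith

/-- Only the light outcomes are balanced: each bin is then at most `δ` below their mean load.
Heavier outcomes can only add mass. -/
theorem exists_image_ge {X Y : Type*} [Fintype X] [DecidableEq Y] [Fintype Y] [Nonempty Y]
    {P : X → ℝ} (hP : ∀ x, 0 ≤ P x) {δ : ℝ} (hδ : 0 ≤ δ) {M : ℕ} (hM : Fintype.card Y = M) :
    ∃ f : X → Y, ∀ y, (∑ x with P x ≤ δ, P x) - δ * M ≤ M * image f P y := by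
  obtain ⟨f, hf⟩ := exists_balanced_assignment (Y := Y) (w := P) hδ
    (Finset.univ.filter fun x => P x ≤ δ) fun x hx => ⟨hP x, (Finset.mem_filter.1 hx).2⟩
  refine ⟨f, fun y => ?_⟩
  have h1 : ∑ x with P x ≤ δ, P x ≤ M * (∑ x ∈ Finset.univ.filter (fun x => P x ≤ δ) with f x = y, P x + δ) := by
    rw [← Finset.sum_fiberwise (Finset.univ.filter fun x => P x ≤ δ) f P]
    refine (Finset.sum_le_sum fun z _ => hf z y).trans ?_
    rw [Finset.sum_const, Finset.card_univ, hM, nsmul_eq_mul]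
  have h2 : ∑ x ∈ Finset.univ.filter (fun x => P x ≤ δ) with f x = y, P x ≤ image f P y :=
    Finset.sum_le_sum_of_subset_of_nonneg
      (Finset.filter_subset_filter _ (Finset.subset_univ _)) fun x _ _ => hP x
  have h3 := mul_le_mul_of_nonneg_left h2 (Nat.cast_nonneg (α := ℝ) M)
  linarith

section OneShot

variable {X Y : Type*} [Fintype X] [Fintype Y] {P : X → ℝ} {M : ℕ} {N : ℝ}

theorem fidM_nonneg (P : X → ℝ) (Q : Y → ℝ) (N : ℝ) : 0 ≤ fidM P Q N := by
  refine Real.sSup_nonneg ?_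
  rintro _ ⟨_, _, _, _, _, _, rfl⟩
  exact fidelity_nonneg _ _

theorem fidD_nonneg [DecidableEq Y] (P : X → ℝ) (Q : Y → ℝ) (N : ℝ) : 0 ≤ fidD P Q N := by
  refine Real.sSup_nonneg ?_
  rintro _ ⟨_, _, rfl⟩
  exact fidelity_nonneg _ _

theorem fidM_const_le (hP : P ∈ stdSimplex ℝ X) (hM : Fintype.card Y = M) (S : Finset X) :
    fidM P (fun _ : Y => (M : ℝ)⁻¹) N ≤ √(S.card / M) + √(1 - ∑ x ∈ S, P x) := by
  refine Real.sSup_le ?_ (by positivity)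
  rintro _ ⟨_, _, _, hR, h₁, h₂, rfl⟩
  exact fidelity_const_le hP hR (h₁.trans h₂) hM S

theorem fidM_const_le_sqrt_storage (hM : Fintype.card Y = M) :
    fidM P (fun _ : Y => (M : ℝ)⁻¹) N ≤ √((2 : ℝ) ^ N / M) := by
  refine Real.sSup_le ?_ (by positivity)
  rintro _ ⟨P', hP', _, hR, -, h, rfl⟩
  refine (fidelity_const_le hP' hR h hM Finset.univ).trans ?_
  rw [hP'.2, sub_self, Real.sqrt_zero, add_zero, Finset.card_univ, Fintype.card_fin]
  gcongr
  exact Nat.floor_le (by positivity)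

theorem fidD_const_le_fidM [DecidableEq Y] (hP : P ∈ stdSimplex ℝ X)
    (hM : Fintype.card Y = M) :
    fidD P (fun _ : Y => (M : ℝ)⁻¹) N ≤ fidM P (fun _ : Y => (M : ℝ)⁻¹) N := by
  refine Real.sSup_le ?_ (fidM_nonneg _ _ _)
  rintro _ ⟨W, W', rfl⟩
  -- The choice `S = ∅` bounds all fidelities by `1`, giving the boundedness that the supremum
  -- requires.
  refine le_csSup ⟨√(0 / M) + √(1 - 0), ?_⟩ ?_
  · rintro _ ⟨_, _, _, hR, h₁, h₂, rfl⟩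
    simpa using fidelity_const_le hP hR (h₁.trans h₂) hM ∅
  · have h := image_mem_stdSimplex hP W
    exact ⟨_, h, _, image_mem_stdSimplex h W', majorized_image hP W, majorized_image h W', rfl⟩

/-- The target alphabet embeds in the storage, so every map `X → Y` factors through it. In the
balanced image each point has mass at least `q / M`, whence fidelity at least `√q`. -/
theorem le_fidD_const [DecidableEq Y] (hP : P ∈ stdSimplex ℝ X) (hM : Fintype.card Y = M)
    (hM0 : 0 < M) (hMN : (M : ℝ) ≤ (2 : ℝ) ^ N) {δ : ℝ} (hδ : 0 ≤ δ) :
    √((∑ x with P x ≤ δ, P x) - δ * M) ≤ fidD P (fun _ : Y => (M : ℝ)⁻¹) N := by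
  have : Nonempty Y := Fintype.card_pos_iff.1 (hM ▸ hM0)
  obtain ⟨f, hf⟩ := exists_image_ge (Y := Y) hP.1 hδ hM
  obtain ⟨e⟩ : Nonempty (Y ↪ Storage N) := by
    rw [Function.Embedding.nonempty_iff_card_le, hM, Fintype.card_fin]
    exact Nat.le_floor hMN
  have hMR : (0 : ℝ) < M := Nat.cast_pos.2 hM0
  have hle : √((∑ x with P x ≤ δ, P x) - δ * M) ≤
      fidelity (image f P) (fun _ : Y => (M : ℝ)⁻¹) := by
    set q := (∑ x with P x ≤ δ, P x) - δ * M
    have h1 : ∀ y : Y, √q * (M : ℝ)⁻¹ ≤ √(image f P y) * √((M : ℝ)⁻¹) := by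
      intro y
      have h2 : √q * √((M : ℝ)⁻¹) ≤ √(image f P y) := by
        rw [← Real.sqrt_mul' _ (by positivity)]
        apply Real.sqrt_le_sqrt
        rw [← div_eq_mul_inv, div_le_iff₀ hMR, mul_comm]
        exact hf y
      calc √q * (M : ℝ)⁻¹ = √q * √((M : ℝ)⁻¹) * √((M : ℝ)⁻¹) := by
            rw [mul_assoc, Real.mul_self_sqrt (by positivity)]
        _ ≤ _ := by gcongr
    calc √q = ∑ _y : Y, √q * (M : ℝ)⁻¹ := by
          rw [Finset.sum_const, Finset.card_univ, hM, nsmul_eq_mul]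
          field_simp
      _ ≤ _ := Finset.sum_le_sum fun y _ => h1 y
  refine hle.trans (le_csSup ⟨√(0 / M) + √(1 - 0), ?_⟩ ⟨e ∘ f, Function.invFun e, ?_⟩)
  · rintro _ ⟨W, W', rfl⟩
    have h := image_mem_stdSimplex hP W
    simpa using fidelity_const_le hP (image_mem_stdSimplex h W')
      ((majorized_image hP W).trans (majorized_image h W')) hM ∅
  · rw [image_image, ← Function.comp_assoc, Function.invFun_comp e.injective, Function.id_comp]

end OneShot

/-! ### The normal distribution function -/

section Gaussian

theorem Phi_eq (x : ℝ) : Phi x = (gaussianReal 0 1).real (Set.Iic x) := cdf_eq_real _ x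

theorem Phi_neg (x : ℝ) : Phi (-x) = 1 - Phi x := by
  have : NullSingletonClass (gaussianReal 0 1) := nullSingletonClass_gaussianReal one_ne_zero
  have hmap : (gaussianReal 0 1).map (fun y => -y) = gaussianReal 0 1 := by
    rw [gaussianReal_map_neg, neg_zero]
  rw [Phi_eq, Phi_eq, ← probReal_compl_eq_one_sub measurableSet_Iic, Set.compl_Iic]
  conv_lhs => rw [← hmap, map_measureReal_apply measurable_neg measurableSet_Iic]
  have : (fun y : ℝ => -y) ⁻¹' Set.Iic (-x) = Set.Ici x := by ext y; simp
  rw [this, measureReal_congr Ioi_ae_eq_Ici]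

theorem Phi_strictMono : StrictMono Phi := by
  intro x y hxy
  rw [Phi_eq, Phi_eq, ← Set.Iic_union_Ioc_eq_Iic hxy.le,
    measureReal_union (Set.Iic_disjoint_Ioc le_rfl) measurableSet_Ioc]
  have h : gaussianReal 0 1 (Set.Ioc x y) ≠ 0 := by
    intro h0
    have := gaussianReal_absolutelyContinuous' 0 one_ne_zero h0
    rw [Real.volume_Ioc, ENNReal.ofReal_eq_zero] at this
    linarith
  have : 0 < (gaussianReal 0 1).real (Set.Ioc x y) :=
    ENNReal.toReal_pos h (measure_ne_top _ _)
  linarith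

theorem Phi_continuous : Continuous Phi := by
  have : NullSingletonClass (gaussianReal 0 1) := nullSingletonClass_gaussianReal one_ne_zero
  rw [continuous_iff_continuousAt]
  intro x
  have h := (cdf (gaussianReal 0 1)).measure_singleton x
  rw [measure_cdf, measure_singleton, eq_comm, ENNReal.ofReal_eq_zero, sub_nonpos] at h
  refine (monotone_cdf (gaussianReal 0 1)).continuousAt_iff_leftLim_eq_rightLim.2 ?_
  rw [StieltjesFunction.rightLim_eq]
  exact le_antisymm ((monotone_cdf (gaussianReal 0 1)).leftLim_le le_rfl) h

theorem Phi_pos (x : ℝ) : 0 < Phi x :=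
  (cdf_nonneg _ (x - 1)).trans_lt (Phi_strictMono (by linarith))

end Gaussian

/-! ### Entropy, varentropy and i.i.d. distributions -/

section Entropy

variable {X : Type*} [Fintype X] {P : X → ℝ}

theorem le_one_of_mem_stdSimplex (hP : P ∈ stdSimplex ℝ X) (x : X) : P x ≤ 1 :=
  hP.2 ▸ Finset.single_le_sum (fun y _ => hP.1 y) (Finset.mem_univ x)

theorem varentropy_pos (hP : P ∈ stdSimplex ℝ X) (h : NonUniform P) : 0 < varentropy P := by
  obtain ⟨x, y, hx, hy, hxy⟩ := h
  have hnn : ∀ z ∈ Finset.univ, 0 ≤ P z * (-Real.logb 2 (P z) - entropy P) ^ 2 :=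
    fun z _ => mul_nonneg (hP.1 z) (sq_nonneg _)
  refine lt_of_le_of_ne (Finset.sum_nonneg hnn) fun h0 => hxy ?_
  have h1 := (Finset.sum_eq_zero_iff_of_nonneg hnn).1 h0.symm
  have h2 : ∀ z, 0 < P z → Real.logb 2 (P z) = -entropy P := by
    intro z hz
    have := h1 z (Finset.mem_univ z)
    rcases mul_eq_zero.1 this with h | h
    · exact absurd h hz.ne'
    · have := pow_eq_zero_iff (two_ne_zero) |>.1 h
      linarith
  exact Real.logb_injOn_pos one_lt_two hx hy ((h2 x hx).trans (h2 y hy).symm)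

theorem entropy_pos (hP : P ∈ stdSimplex ℝ X) (h : NonUniform P) : 0 < entropy P := by
  obtain ⟨x, hx0, hx1⟩ : ∃ x, 0 < P x ∧ P x < 1 := by
    obtain ⟨x, y, hx, hy, hxy⟩ := h
    rcases hxy.lt_or_gt with h | h
    · exact ⟨x, hx, h.trans_le (le_one_of_mem_stdSimplex hP y)⟩
    · exact ⟨y, hy, h.trans_le (le_one_of_mem_stdSimplex hP x)⟩
  rw [entropy, neg_pos]
  refine Finset.sum_neg' (fun z _ => ?_) ⟨x, Finset.mem_univ x, ?_⟩
  · exact mul_nonpos_of_nonneg_of_nonpos (hP.1 z)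
      (Real.logb_nonpos one_lt_two (hP.1 z) (le_one_of_mem_stdSimplex hP z))
  · exact mul_neg_of_pos_of_neg hx0 (Real.logb_neg one_lt_two hx0 hx1)

theorem entropy_unif {l : ℕ} (hl : 2 ≤ l) : entropy (unif l) = Real.logb 2 l := by
  have : (l : ℝ) ≠ 0 := by positivity
  simp [entropy, unif, this]

theorem iid_mem_stdSimplex (hP : P ∈ stdSimplex ℝ X) (n : ℕ) :
    iid P n ∈ stdSimplex ℝ (Fin n → X) := by
  classical
  refine ⟨fun x => Finset.prod_nonneg fun i _ => hP.1 _, ?_⟩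
  have := Finset.prod_univ_sum (fun _ : Fin n => (Finset.univ : Finset X)) (fun _ x => P x)
  rw [Fintype.piFinset_univ] at this
  simp only [iid, ← this, hP.2, Finset.prod_const_one]

theorem iid_unif (l T : ℕ) : iid (unif l) T = fun _ => ((l ^ T : ℕ) : ℝ)⁻¹ := by
  funext x
  simp [iid, unif]

end Entropy

/-! ### Central limit theorem for the log-likelihood -/

section CLT

/-- The central limit theorem for an i.i.d. sequence on a finite alphabet, in terms of finite sums. -/
theorem tendsto_sum_iid {X : Type*} [Fintype X] {P : X → ℝ} (hP : P ∈ stdSimplex ℝ X)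
    (f : X → ℝ) (hV : 0 < ∑ x, P x * (f x - ∑ y, P y * f y) ^ 2) (a : ℝ) :
    Tendsto (fun n : ℕ => ∑ x : Fin n → X with
        ∑ i, f (x i) ≤ (∑ y, P y * f y) * n + a * √(n : ℝ), iid P n x) atTop
      (𝓝 (Phi (a / √(∑ x, P x * (f x - ∑ y, P y * f y) ^ 2)))) := by
  classical
  set m := ∑ y, P y * f y with hm
  set V := ∑ x, P x * (f x - m) ^ 2 with hVdef
  let _ : MeasurableSpace X := ⊤
  have : DiscreteMeasurableSpace X := ⟨fun _ => trivial⟩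
  let p : PMF X := PMF.ofFintype (fun x => ENNReal.ofReal (P x)) (by
    rw [← ENNReal.ofReal_sum_of_nonneg fun x _ => hP.1 x, hP.2, ENNReal.ofReal_one])
  have hpx : ∀ x, (p x).toReal = P x := fun x => by
    simp [p, ENNReal.toReal_ofReal (hP.1 x)]
  let μ : Measure X := p.toMeasure
  let ν : Measure (ℕ → X) := Measure.infinitePi fun _ => μ
  have hint : ∀ g : X → ℝ, ∫ x, g x ∂μ = ∑ x, P x * g x := fun g => by
    rw [PMF.integral_eq_sum]
    simp [hpx]
  let Y : ℕ → (ℕ → X) → ℝ := fun i ω => (f (ω i) - m) / √V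
  have hmeas : ∀ g : X → ℝ, Measurable g := fun g => measurable_of_finite g
  have hev : ∀ i, MeasurePreserving (fun ω : ℕ → X => ω i) ν μ :=
    fun i => measurePreserving_eval_infinitePi (fun _ => μ) i
  have hYint : ∀ (g : X → ℝ), ∫ ω, g (ω 0) ∂ν = ∑ x, P x * g x := fun g => by
    rw [← hint, ← (hev 0).map_eq,
      integral_map (hev 0).measurable.aemeasurable (hmeas g).aestronglyMeasurable]
  have hclt := tendstoInDistribution_inv_sqrt_mul_sum (P := ν) (P' := gaussianReal 0 1)
    (X := Y) (Y := id) (HasLaw.id) ?_ ?_ ?_ ?_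
  · have hnoatom : NullSingletonClass (gaussianReal 0 1) := nullSingletonClass_gaussianReal one_ne_zero
    have h := ProbabilityMeasure.tendsto_measure_of_null_frontier_of_tendsto' hclt.tendsto
      (E := Set.Iic (a / √V)) (by
        change (gaussianReal 0 1).map id (frontier (Set.Iic (a / √V))) = 0
        rw [Measure.map_id, frontier_Iic, measure_singleton])
    have htop : (gaussianReal 0 1).map id (Set.Iic (a / √V)) ≠ ⊤ := by
      rw [Measure.map_id]; exact measure_ne_top _ _
    have h' := (ENNReal.tendsto_toReal htop).comp h
    have hlim : ((gaussianReal 0 1).map id (Set.Iic (a / √V))).toReal = Phi (a / √V) := by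
      rw [Measure.map_id, Phi_eq]; rfl
    refine (hlim ▸ h').congr' ?_
    filter_upwards [eventually_gt_atTop 0] with n hn
    have hn' : 0 < √(n : ℝ) := Real.sqrt_pos.2 (Nat.cast_pos.2 hn)
    have hV' : 0 < √V := Real.sqrt_pos.2 hV
    have hmp : ν.map (fun ω (i : Fin n) => ω i) = Measure.infinitePi fun _ : Fin n => μ :=
      Measure.map_infinitePi_infinitePi_of_inj (f := fun i : Fin n => (i : ℕ))
        (P := fun _ => μ) Fin.val_injective
    have hmeasn : Measurable (fun (ω : ℕ → X) (i : Fin n) => ω i) := by fun_prop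
    let A : Finset (Fin n → X) :=
      Finset.univ.filter fun x => ∑ i, f (x i) ≤ m * n + a * √(n : ℝ)
    -- The event depends only on the first `n` coordinates, so its probability is a finite sum over
    -- `A`.
    have hpre : (fun ω => (√(n : ℝ))⁻¹ * ∑ k ∈ Finset.range n, Y k ω) ⁻¹' Set.Iic (a / √V) =
        (fun (ω : ℕ → X) (i : Fin n) => ω i) ⁻¹' (A : Set (Fin n → X)) := by
      ext ω
      simp only [Set.mem_preimage, Set.mem_Iic, A, Finset.coe_filter, Finset.mem_univ, true_and,
        Set.mem_ofPred_eq, Y]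
      rw [← Finset.sum_div, Finset.sum_sub_distrib, Finset.sum_const, Finset.card_range,
        nsmul_eq_mul, ← mul_div_assoc, div_le_div_iff_of_pos_right hV', inv_mul_le_iff₀ hn',
        sub_le_iff_le_add, Finset.sum_range fun i => f (ω i)]
      constructor <;> intro h <;> linarith
    have hfin : (Measure.infinitePi fun _ : Fin n => μ).real (A : Set (Fin n → X)) =
        ∑ x ∈ A, iid P n x := by
      rw [← sum_measureReal_singleton]
      refine Finset.sum_congr rfl fun x _ => ?_
      rw [measureReal_def, Measure.infinitePi_singleton_of_fintype, ENNReal.toReal_prod]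
      refine Finset.prod_congr rfl fun i _ => ?_
      rw [← hpx]
      simp only [μ]
      rw [PMF.toMeasure_apply_singleton _ _ (measurableSet_singleton _)]
    change (ν.map _ (Set.Iic (a / √V))).toReal = ∑ x ∈ A, iid P n x
    have hYm : Measurable fun ω => (√(n : ℝ))⁻¹ * ∑ k ∈ Finset.range n, Y k ω :=
      Measurable.const_mul (Finset.measurable_fun_sum _ fun i _ =>
        (hmeas fun x => (f x - m) / √V).comp (hev i).measurable) _
    rw [← hfin, ← hmp, measureReal_def, Measure.map_apply hmeasn A.measurableSet, ← hpre,
      Measure.map_apply hYm measurableSet_Iic]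
  · refine (hYint fun x => (f x - m) / √V).trans ?_
    simp only [← mul_div_assoc, ← Finset.sum_div, mul_sub, Finset.sum_sub_distrib,
      ← Finset.sum_mul, hP.2]
    rw [← hm]; simp
  · refine (hYint fun x => ((f x - m) / √V) ^ 2).trans ?_
    simp only [div_pow, ← mul_div_assoc, ← Finset.sum_div, Real.sq_sqrt hV.le]
    exact div_self hV.ne'
  · exact iIndepFun_infinitePi (P := fun _ => μ) (X := fun _ x => (f x - m) / √V)
      fun _ => hmeas _
  · intro i
    have h0 : IdentDistrib (fun ω : ℕ → X => ω i) (fun ω => ω 0) ν ν :=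
      ⟨(hev i).measurable.aemeasurable, (hev 0).measurable.aemeasurable, by
        rw [(hev i).map_eq, (hev 0).map_eq]⟩
    exact h0.comp (hmeas fun x => (f x - m) / √V)

/-- Second-order asymptotic equipartition: the mass of the sequences of probability at least
`2 ^ (-(n H(P) + a √n))`. -/
theorem tendsto_sum_iid_ge {X : Type*} [Fintype X] {P : X → ℝ} (hP : P ∈ stdSimplex ℝ X)
    (hV : 0 < varentropy P) (a : ℝ) :
    Tendsto (fun n : ℕ => ∑ x : Fin n → X with
        (2 : ℝ) ^ (-(entropy P * n + a * √(n : ℝ))) ≤ iid P n x, iid P n x) atTop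
      (𝓝 (Phi (a / √(varentropy P)))) := by
  have hm : ∑ y, P y * -Real.logb 2 (P y) = entropy P := by simp [entropy]
  have h := tendsto_sum_iid hP (fun x => -Real.logb 2 (P x)) (by rw [hm]; exact hV) a
  rw [hm] at h
  refine h.congr fun n => ?_
  rw [Finset.sum_filter, Finset.sum_filter]
  refine Finset.sum_congr rfl fun x _ => ?_
  -- Null sequences must be set aside: `logb 2 0 = 0`, so the two conditions may disagree there, but
  -- they carry no mass.
  rcases ((iid_mem_stdSimplex hP n).1 x).eq_or_lt with h0 | h0
  · simp [← h0]
  · have hpos : ∀ i ∈ Finset.univ, P (x i) ≠ 0 := fun i hi h1 =>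
      h0.ne' (Finset.prod_eq_zero hi h1)
    have hlog : Real.logb 2 (iid P n x) = ∑ i, Real.logb 2 (P (x i)) :=
      Real.logb_prod _ _ hpos
    have : (∑ i, -Real.logb 2 (P (x i)) ≤ entropy P * n + a * √(n : ℝ)) ↔
        (2 : ℝ) ^ (-(entropy P * n + a * √(n : ℝ))) ≤ iid P n x := by
      rw [← Real.le_logb_iff_rpow_le one_lt_two h0, hlog, Finset.sum_neg_distrib, neg_le]
    simp only [this]

end CLT

/-! ### Second-order asymptotics -/

section Asymptotics

theorem tendsto_two_rpow_neg_mul_sqrt {c : ℝ} (hc : 0 < c) :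
    Tendsto (fun n : ℕ => (2 : ℝ) ^ (-(c * √(n : ℝ)))) atTop (𝓝 0) :=
  (tendsto_rpow_atBot_of_base_gt_one 2 one_lt_two).comp <| tendsto_neg_atTop_atBot.comp <|
    (Real.tendsto_sqrt_atTop.comp tendsto_natCast_atTop_atTop).const_mul_atTop hc

theorem logb_two_pos {l : ℕ} (hl : 2 ≤ l) : 0 < Real.logb 2 l :=
  Real.logb_pos one_lt_two (by exact_mod_cast hl)

theorem natCast_pow_eq_two_rpow {l : ℕ} (hl : 2 ≤ l) (T : ℕ) :
    ((l ^ T : ℕ) : ℝ) = (2 : ℝ) ^ (Real.logb 2 l * T) := by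
  have hl0 : (0 : ℝ) < l := by positivity
  rw [Real.rpow_mul zero_le_two, Real.rpow_logb two_pos (by norm_num) hl0, Real.rpow_natCast,
    Nat.cast_pow]

/-- The factor `l` pays for rounding down. Negative `x` is allowed, since the floor is then `0`. -/
theorem two_rpow_le_pow_floor {l : ℕ} (hl : 2 ≤ l) (x : ℝ) :
    (2 : ℝ) ^ (Real.logb 2 l * x) ≤ l * ((l ^ ⌊x⌋₊ : ℕ) : ℝ) := by
  have hl0 : (0 : ℝ) < l := by positivity
  have hG := logb_two_pos hl
  have h1 : (l : ℝ) = 2 ^ Real.logb 2 l := by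
    rw [Real.rpow_logb two_pos (by norm_num) hl0]
  conv_rhs => rw [natCast_pow_eq_two_rpow hl]
  conv_rhs => enter [1]; rw [h1]
  rw [← Real.rpow_add two_pos, ← mul_one_add]
  gcongr
  · exact one_le_two
  · linarith [Nat.lt_floor_add_one x]

theorem pow_floor_le_two_rpow {l : ℕ} (hl : 2 ≤ l) {x : ℝ} (hx : 0 ≤ x) :
    ((l ^ ⌊x⌋₊ : ℕ) : ℝ) ≤ (2 : ℝ) ^ (Real.logb 2 l * x) := by
  have hG := logb_two_pos hl
  rw [natCast_pow_eq_two_rpow hl]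
  gcongr
  · exact one_le_two
  · exact Nat.floor_le hx

theorem eventually_rate_nonneg {r : ℝ} (hr : 0 < r) (t : ℝ) :
    ∀ᶠ n : ℕ in atTop, 0 ≤ r * n + t * √(n : ℝ) := by
  have h : Tendsto (fun n : ℕ => r * √(n : ℝ)) atTop atTop :=
    (Real.tendsto_sqrt_atTop.comp tendsto_natCast_atTop_atTop).const_mul_atTop hr
  filter_upwards [h.eventually_ge_atTop (-t)] with n hn
  have h1 : r * n + t * √(n : ℝ) = (r * √(n : ℝ) + t) * √(n : ℝ) := by
    rw [add_mul, mul_assoc, Real.mul_self_sqrt (Nat.cast_nonneg n)]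
  rw [h1]
  exact mul_nonneg (by linarith) (Real.sqrt_nonneg _)

variable {X : Type*} [Fintype X] {P : X → ℝ} {l : ℕ}

theorem logb_mul_rate (hl : 2 ≤ l) (t : ℝ) (n : ℕ) :
    Real.logb 2 l * (entropy P / entropy (unif l) * n + t * √(n : ℝ)) =
      entropy P * n + Real.logb 2 l * t * √(n : ℝ) := by
  have := (logb_two_pos hl).ne'
  rw [entropy_unif hl]
  field_simp

/-- The total mass is `1`, which limits how many sequences can have mass at least `2 ^ (-c)`. -/
theorem card_iid_ge_le (hP : P ∈ stdSimplex ℝ X) (n : ℕ) (c : ℝ) :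
    ((Finset.univ.filter fun x : Fin n → X => (2 : ℝ) ^ (-c) ≤ iid P n x).card : ℝ) ≤
      (2 : ℝ) ^ c := by
  have hn := iid_mem_stdSimplex hP n
  have h1 := Finset.card_nsmul_le_sum
    (Finset.univ.filter fun x : Fin n → X => (2 : ℝ) ^ (-c) ≤ iid P n x) (iid P n)
    ((2 : ℝ) ^ (-c)) fun x hx => (Finset.mem_filter.1 hx).2
  have h2 := Finset.sum_le_sum_of_subset_of_nonneg
    (Finset.subset_univ (Finset.univ.filter fun x : Fin n → X => (2 : ℝ) ^ (-c) ≤ iid P n x))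
    fun x _ _ => hn.1 x
  rw [hn.2] at h2
  have h3 := h1.trans h2
  have h4 : (2 : ℝ) ^ (-c) * (2 : ℝ) ^ c = 1 := by
    rw [← Real.rpow_add two_pos, neg_add_cancel, Real.rpow_zero]
  rw [nsmul_eq_mul, ← h4, mul_comm] at h3
  exact le_of_mul_le_mul_left h3 (by positivity)

theorem fidM_iid_le (hP : P ∈ stdSimplex ℝ X) (hl : 2 ≤ l) (t a N : ℝ) (n : ℕ) :
    fidM (iid P n) (iid (unif l) ⌊entropy P / entropy (unif l) * n + t * √(n : ℝ)⌋₊) N ≤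
      √(l * (2 : ℝ) ^ (-((Real.logb 2 l * t - a) * √(n : ℝ)))) +
        √(1 - ∑ x : Fin n → X with
          (2 : ℝ) ^ (-(entropy P * n + a * √(n : ℝ))) ≤ iid P n x, iid P n x) := by
  rw [iid_unif]
  refine (fidM_const_le (iid_mem_stdSimplex hP n) (by simp)
    (Finset.univ.filter fun x =>
      (2 : ℝ) ^ (-(entropy P * n + a * √(n : ℝ))) ≤ iid P n x)).trans ?_
  gcongr
  have hM := two_rpow_le_pow_floor hl (entropy P / entropy (unif l) * n + t * √(n : ℝ))
  rw [logb_mul_rate hl] at hM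
  have hl0 : 0 < l := by omega
  rw [div_le_iff₀ (by positivity)]
  refine (card_iid_ge_le hP n _).trans ?_
  calc (2 : ℝ) ^ (entropy P * n + a * √(n : ℝ))
      = (2 : ℝ) ^ (-((Real.logb 2 l * t - a) * √(n : ℝ))) *
        (2 : ℝ) ^ (entropy P * n + Real.logb 2 l * t * √(n : ℝ)) := by
        rw [← Real.rpow_add two_pos]; congr 1; ring
    _ ≤ (2 : ℝ) ^ (-((Real.logb 2 l * t - a) * √(n : ℝ))) * (l * _) := by gcongr
    _ = _ := by ring

theorem fidM_iid_le_of_storage (hl : 2 ≤ l) (t s : ℝ) (n : ℕ) :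
    fidM (iid P n) (iid (unif l) ⌊entropy P / entropy (unif l) * n + t * √(n : ℝ)⌋₊)
      (entropy P * n + s * √(n : ℝ)) ≤
      √(l * (2 : ℝ) ^ (-((Real.logb 2 l * t - s) * √(n : ℝ)))) := by
  rw [iid_unif]
  refine (fidM_const_le_sqrt_storage (by simp)).trans ?_
  gcongr
  have hM := two_rpow_le_pow_floor hl (entropy P / entropy (unif l) * n + t * √(n : ℝ))
  rw [logb_mul_rate hl] at hM
  have hl0 : 0 < l := by omega
  rw [div_le_iff₀ (by positivity)]
  calc (2 : ℝ) ^ (entropy P * n + s * √(n : ℝ))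
      = (2 : ℝ) ^ (-((Real.logb 2 l * t - s) * √(n : ℝ))) *
        (2 : ℝ) ^ (entropy P * n + Real.logb 2 l * t * √(n : ℝ)) := by
        rw [← Real.rpow_add two_pos]; congr 1; ring
    _ ≤ (2 : ℝ) ^ (-((Real.logb 2 l * t - s) * √(n : ℝ))) * (l * _) := by gcongr
    _ = _ := by ring

theorem le_fidD_iid (hP : P ∈ stdSimplex ℝ X) (hl : 2 ≤ l) {t s : ℝ} (b : ℝ)
    (hts : Real.logb 2 l * t ≤ s) {n : ℕ}
    (hn : 0 ≤ entropy P / entropy (unif l) * n + t * √(n : ℝ)) :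
    √(1 - (∑ x : Fin n → X with
          (2 : ℝ) ^ (-(entropy P * n + b * √(n : ℝ))) ≤ iid P n x, iid P n x) -
        (2 : ℝ) ^ (-((b - Real.logb 2 l * t) * √(n : ℝ)))) ≤
      fidD (iid P n) (iid (unif l) ⌊entropy P / entropy (unif l) * n + t * √(n : ℝ)⌋₊)
        (entropy P * n + s * √(n : ℝ)) := by
  have hl0 : 0 < l := by omega
  have hM := pow_floor_le_two_rpow hl hn
  rw [logb_mul_rate hl] at hM
  rw [iid_unif]
  have hMN : ((l ^ ⌊entropy P / entropy (unif l) * n + t * √(n : ℝ)⌋₊ : ℕ) : ℝ) ≤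
      (2 : ℝ) ^ (entropy P * n + s * √(n : ℝ)) := by
    refine hM.trans ?_
    gcongr
    exact one_le_two
  refine le_trans ?_ (le_fidD_const (iid_mem_stdSimplex hP n) (by simp)
    (Nat.pow_pos hl0) hMN
    (by positivity : 0 ≤ (2 : ℝ) ^ (-(entropy P * n + b * √(n : ℝ)))))
  apply Real.sqrt_le_sqrt
  refine sub_le_sub ?_ ?_
  · have h1 := Finset.sum_filter_add_sum_filter_not Finset.univ
      (fun x => (2 : ℝ) ^ (-(entropy P * n + b * √(n : ℝ))) ≤ iid P n x) (iid P n)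
    rw [(iid_mem_stdSimplex hP n).2] at h1
    rw [sub_le_iff_le_add', ← h1]
    gcongr 1
    refine Finset.sum_le_sum_of_subset_of_nonneg ?_ fun x _ _ => (iid_mem_stdSimplex hP n).1 x
    intro x hx
    simp only [Finset.mem_filter, Finset.mem_univ, true_and, not_le] at hx ⊢
    exact hx.le
  · calc _ ≤ (2 : ℝ) ^ (-(entropy P * n + b * √(n : ℝ))) *
          (2 : ℝ) ^ (entropy P * n + Real.logb 2 l * t * √(n : ℝ)) := by gcongr
      _ = _ := by rw [← Real.rpow_add two_pos]; congr 1; ring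

theorem fidD_iid_le_fidM_iid (hP : P ∈ stdSimplex ℝ X) (n T : ℕ) (N : ℝ) :
    fidD (iid P n) (iid (unif l) T) N ≤ fidM (iid P n) (iid (unif l) T) N := by
  rw [iid_unif]
  exact fidD_const_le_fidM (iid_mem_stdSimplex hP n) (by simp)

/-- The limit fidelity of the conversions of `P` into uniform bits through restricted storage. -/
noncomputable def limitFid (P : X → ℝ) (l : ℕ) (s₂ t₂ : ℝ) : ℝ :=
  if Real.logb 2 l * t₂ ≤ s₂ then √(Phi (-Real.logb 2 l / √(varentropy P) * t₂)) else 0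

theorem Phi_neg_rate (l : ℕ) (V t : ℝ) :
    Phi (-Real.logb 2 l / √V * t) = 1 - Phi (Real.logb 2 l * t / √V) := by
  rw [← Phi_neg]; congr 1; ring

theorem eventually_fidM_lt (hP : P ∈ stdSimplex ℝ X) (hPnon : NonUniform P) (hl : 2 ≤ l)
    {s₂ t₂ u : ℝ} (hu : limitFid P l s₂ t₂ < u) :
    ∀ᶠ n : ℕ in atTop,
      fidM (iid P n) (iid (unif l) ⌊entropy P / entropy (unif l) * n + t₂ * √(n : ℝ)⌋₊)
        (entropy P * n + s₂ * √(n : ℝ)) < u := by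
  have hdecay : ∀ {c : ℝ}, 0 < c →
      Tendsto (fun n : ℕ => √(l * (2 : ℝ) ^ (-(c * √(n : ℝ))))) atTop (𝓝 0) := by
    intro c hc
    simpa using ((tendsto_two_rpow_neg_mul_sqrt hc).const_mul (l : ℝ)).sqrt
  unfold limitFid at hu
  split_ifs at hu with hts
  · rw [Phi_neg_rate] at hu
    have hcont : Continuous fun a : ℝ => √(1 - Phi (a / √(varentropy P))) :=
      Real.continuous_sqrt.comp (continuous_const.sub
        (Phi_continuous.comp (continuous_id.div_const _)))
    -- Continuity of `Φ` leaves room to take `a` strictly below `(log l) t₂`, which makes the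
    -- cardinality term decay.
    obtain ⟨a, hau, ha⟩ : ∃ a, √(1 - Phi (a / √(varentropy P))) < u ∧
        a < Real.logb 2 l * t₂ :=
      (((hcont.tendsto _).mono_left nhdsWithin_le_nhds |>.eventually_lt_const hu).and
        (self_mem_nhdsWithin (s := Set.Iio (Real.logb 2 l * t₂)))).exists
    have hlim := (hdecay (sub_pos.2 ha)).add
      ((tendsto_sum_iid_ge hP (varentropy_pos hP hPnon) a).const_sub 1).sqrt
    rw [zero_add] at hlim
    filter_upwards [hlim.eventually_lt_const hau] with n hn
    exact (fidM_iid_le hP hl t₂ a _ n).trans_lt hn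
  · filter_upwards [(hdecay (sub_pos.2 (not_le.1 hts))).eventually_lt_const hu] with n hn
    exact (fidM_iid_le_of_storage hl t₂ s₂ n).trans_lt hn

theorem eventually_lt_fidD (hP : P ∈ stdSimplex ℝ X) (hPnon : NonUniform P) (hl : 2 ≤ l)
    {s₂ t₂ u : ℝ} (hu : u < limitFid P l s₂ t₂) :
    ∀ᶠ n : ℕ in atTop,
      u < fidD (iid P n) (iid (unif l) ⌊entropy P / entropy (unif l) * n + t₂ * √(n : ℝ)⌋₊)
        (entropy P * n + s₂ * √(n : ℝ)) := by
  unfold limitFid at hu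
  split_ifs at hu with hts
  · rw [Phi_neg_rate] at hu
    have hcont : Continuous fun a : ℝ => √(1 - Phi (a / √(varentropy P))) :=
      Real.continuous_sqrt.comp (continuous_const.sub
        (Phi_continuous.comp (continuous_id.div_const _)))
    -- Here `b` lies strictly above `(log l) t₂`, so that `δ M` decays.
    obtain ⟨b, hbu, hb⟩ : ∃ b, u < √(1 - Phi (b / √(varentropy P))) ∧
        Real.logb 2 l * t₂ < b :=
      (((hcont.tendsto _).mono_left nhdsWithin_le_nhds |>.eventually_const_lt hu).and
        (self_mem_nhdsWithin (s := Set.Ioi (Real.logb 2 l * t₂)))).exists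
    have hlim := (((tendsto_sum_iid_ge hP (varentropy_pos hP hPnon) b).const_sub 1).sub
      (tendsto_two_rpow_neg_mul_sqrt (sub_pos.2 hb))).sqrt
    rw [sub_zero] at hlim
    have hr : 0 < entropy P / entropy (unif l) :=
      div_pos (entropy_pos hP hPnon) (by rw [entropy_unif hl]; exact logb_two_pos hl)
    filter_upwards [hlim.eventually_const_lt hbu, eventually_rate_nonneg hr t₂] with n hn hn0
    exact hn.trans_le (le_fidD_iid hP hl b hts hn0)
  · exact Eventually.of_forall fun n => hu.trans_le (fidD_nonneg _ _ _)

theorem secondFidD_unif (hP : P ∈ stdSimplex ℝ X) (hPnon : NonUniform P) (hl : 2 ≤ l)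
    (s₂ t₂ : ℝ) : secondFidD P (unif l) s₂ t₂ = limitFid P l s₂ t₂ := by
  refine Tendsto.liminf_eq (tendsto_order.2 ⟨fun u hu => eventually_lt_fidD hP hPnon hl hu,
    fun u hu => ?_⟩)
  filter_upwards [eventually_fidM_lt hP hPnon hl hu] with n hn
  exact (fidD_iid_le_fidM_iid hP _ _ _).trans_lt hn

theorem secondFidM_unif (hP : P ∈ stdSimplex ℝ X) (hPnon : NonUniform P) (hl : 2 ≤ l)
    (s₂ t₂ : ℝ) : secondFidM P (unif l) s₂ t₂ = limitFid P l s₂ t₂ := by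
  refine Tendsto.liminf_eq (tendsto_order.2 ⟨fun u hu => ?_,
    fun u hu => eventually_fidM_lt hP hPnon hl hu⟩)
  filter_upwards [eventually_lt_fidD hP hPnon hl hu] with n hn
  exact hn.trans_le (fidD_iid_le_fidM_iid hP _ _ _)

end Asymptotics

end RNC

/-! ### The main theorem -/

theorem mainTheorem7 {X : Type*} [Fintype X] (P : X → ℝ) (hP : P ∈ stdSimplex ℝ X)
    (hPnon : RNC.NonUniform P) (l : ℕ) (hl : 2 ≤ l) (s₂ : ℝ) :
    ∃ F : ℝ → ℝ,
      (∀ t₂ : ℝ, F t₂ = RNC.secondFidD P (RNC.unif l) s₂ t₂ ∧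
        F t₂ = RNC.secondFidM P (RNC.unif l) s₂ t₂) ∧
      ContinuousOn F (F ⁻¹' Set.Ioo 0 1) ∧ StrictAntiOn F (F ⁻¹' Set.Ioo 0 1) ∧
      (∀ t₂ : ℝ, F t₂ =
        if Real.logb 2 l * t₂ ≤ s₂ then
          √(RNC.Phi (-Real.logb 2 l / √(RNC.varentropy P) * t₂))
        else 0) ∧
      (∀ t₂ : ℝ, F t₂ =
        √(1 - RNC.Z0 (s₂ / √(RNC.varentropy P)) (t₂ * RNC.coeffD P (RNC.unif l)))) := by
  have hV : 0 < √(RNC.varentropy P) := Real.sqrt_pos.2 (RNC.varentropy_pos hP hPnon)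
  have hG := RNC.logb_two_pos hl
  have hle : ∀ t ∈ RNC.limitFid P l s₂ ⁻¹' Set.Ioo 0 1, Real.logb 2 l * t ≤ s₂ := by
    intro t ht
    by_contra h
    have : RNC.limitFid P l s₂ t = 0 := if_neg h
    exact ht.1.ne' this
  -- Where the limit is nonzero the first case applies, so it agrees with a globally continuous,
  -- strictly decreasing function.
  have heq : Set.EqOn (RNC.limitFid P l s₂)
      (fun t => √(RNC.Phi (-Real.logb 2 l / √(RNC.varentropy P) * t)))
      (RNC.limitFid P l s₂ ⁻¹' Set.Ioo 0 1) := fun t ht => if_pos (hle t ht)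
  refine ⟨RNC.limitFid P l s₂, fun t => ⟨(RNC.secondFidD_unif hP hPnon hl s₂ t).symm,
    (RNC.secondFidM_unif hP hPnon hl s₂ t).symm⟩, ?_, ?_, fun t => rfl, fun t => ?_⟩
  · refine ContinuousOn.congr (Continuous.continuousOn ?_) heq
    exact Real.continuous_sqrt.comp (RNC.Phi_continuous.comp (continuous_const.mul continuous_id))
  · refine StrictAntiOn.congr ?_ heq.symm
    refine StrictAnti.strictAntiOn (fun x y hxy => ?_) _
    refine Real.sqrt_lt_sqrt (RNC.Phi_pos _).le (RNC.Phi_strictMono ?_)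
    exact mul_lt_mul_of_neg_left hxy (div_neg_of_neg_of_pos (neg_neg_of_pos hG) hV)
  · have hD : t * RNC.coeffD P (RNC.unif l) = Real.logb 2 l * t / √(RNC.varentropy P) := by
      rw [RNC.coeffD, RNC.entropy_unif hl]; ring
    simp only [RNC.limitFid, RNC.Z0, hD, div_le_div_iff_of_pos_right hV]
    split_ifs
    · rw [RNC.Phi_neg_rate]
    · simp
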